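/- Let $d\ge 1$ and let $T_1,\dots,T_d\colon Y\to Y$ be commuting Borel bijections of a standard Borel space $Y$ that generate a free $\mathbb Z^d$-action. Let $\mathcal G=\mathcal G_{T_1,\dots,T_d}$ be the graph on $Y$ whose edges are the pairs $(y,T_j^{\pm1}(y))$ with $y\in Y$ and $1\le j\le d$. A Borel probability measure $\mu$ on $Y$ is called $\mathcal G$-invariant if $\mu\circ\phi^{-1}=\mu$ for every Borel bijection $\phi\colon Y\to Y$ such that $(y,\phi(y))$ is an edge of $\mathcal G$ for every $y\in Y$. A Borel set $N\subset Y$ is called null if $\mu(N)=0$ for every $\mathcal G$-invariant Borel probability measure $\mu$. The almost Borel chromatic number of $\mathcal G$ is the least $k$ for which there are a Borel map $c\colon Y\to\{1,\dots,k\}$ and a null set $N$ such that $c(x)\ne c(y)$ for every edge $(x,y)$ of $\mathcal G$ with $x,y\notin N$. Then the following hold. 1. Let $\mathcal H$ be a finite connected non-bipartite graph (undirected, without multiple edges, self-loops allowed). Then there is a Borel almost graph homomorphism from $\mathcal G$ to $\mathcal H$, that is, a Borel map $f\colon Y\to V_{\mathcal H}$ and a null set $N$ such that $(f(x),f(y))$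 is an edge of $\mathcal H$ for every edge $(x,y)$ of $\mathcal G$ with $x,y\notin N$. 2. The almost Borel chromatic number of $\mathcal G$ is at most $3$. If $Y$ itself is not null (that is, if there is at least one $\mathcal G$-invariant Borel probability measure), then it is either $2$ or $3$. 3. If $Y$ itself is not null, then the almost Borel chromatic number of $\mathcal G$ equals $2$ if and only if there are disjoint Borel sets $Y_0,Y_1\subset Y$ such that $Y\setminus(Y_0\cup Y_1)$ is null and $T_i(Y_j)=Y_{1-j}$ for all $i=1,\dots,d$ and $j=0,1$. -/

import Mathlib

open MeasureTheory

universe u v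

/-- A Borel graph: an undirected graph with at most one edge between any two vertices, self-loops
allowed, whose vertices form a measurable space and whose edge set is measurable. -/
structure BorelGraph (V : Type u) [MeasurableSpace V] where
  Adj : V → V → Prop
  symm : ∀ x y, Adj x y → Adj y x
  measurableSet_adj : MeasurableSet {p : V × V | Adj p.1 p.2}

namespace BorelGraph

variable {V : Type u} [MeasurableSpace V] {W : Type v} [MeasurableSpace W]

/-- `μ` is invariant under every Borel bijection of the vertex set that moves each vertex along
an edge. -/
def Invariant (G : BorelGraph V) (μ : Measure V) : Prop :=
  ∀ φ : V ≃ᵐ V, (∀ x, G.Adj x (φ x)) → μ.map φ = μ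

/-- A Borel set of vertices which has measure zero for every invariant probability measure. -/
def IsNull (G : BorelGraph V) (N : Set V) : Prop :=
  MeasurableSet N ∧ ∀ μ : Measure V, IsProbabilityMeasure μ → G.Invariant μ → μ N = 0

/-- A Borel map of the vertices which is a graph homomorphism away from a null set. -/
def IsAlmostHom (G : BorelGraph V) (H : BorelGraph W) (f : V → W) : Prop :=
  Measurable f ∧ ∃ N : Set V, G.IsNull N ∧
    ∀ x y, x ∉ N → y ∉ N → G.Adj x y → H.Adj (f x) (f y)

/-- There is a Borel map to a set of `k` colors which is a proper coloring away from a null set. -/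
def AlmostBorelColorable (G : BorelGraph V) (k : ℕ) : Prop :=
  ∃ c : V → Fin k, Measurable c ∧ ∃ N : Set V, G.IsNull N ∧
    ∀ x y, x ∉ N → y ∉ N → G.Adj x y → c x ≠ c y

/-- The least `k` such that the graph is almost Borel `k`-colorable (`⊤` if there is none). -/
noncomputable def almostBorelChromaticNumber (G : BorelGraph V) : ℕ∞ :=
  ⨅ k ∈ {k : ℕ | G.AlmostBorelColorable k}, (k : ℕ∞)

/-- Nonempty, and any two vertices are joined by a path. -/
def Connected (G : BorelGraph V) : Prop :=
  Nonempty V ∧ ∀ x y, Relation.ReflTransGen G.Adj x y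

def Bipartite (G : BorelGraph V) : Prop :=
  ∃ c : V → Bool, ∀ x y, G.Adj x y → c x ≠ c y

end BorelGraph

/-- The transformation `T₁ ^ n₁ ⋯ T_d ^ n_d`. -/
def zdMap {Y : Type u} [MeasurableSpace Y] {d : ℕ} (T : Fin d → Y ≃ᵐ Y) (n : Fin d → ℤ) :
    Equiv.Perm Y :=
  (List.ofFn fun i => ((T i).toEquiv : Equiv.Perm Y) ^ n i).prod

/-- `T₁, …, T_d` commute and the action of `ℤ^d` which they generate is free. -/
structure GeneratesFreeZdAction {Y : Type u} [MeasurableSpace Y] {d : ℕ}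
    (T : Fin d → Y ≃ᵐ Y) : Prop where
  comm : ∀ i j y, T i (T j y) = T j (T i y)
  free : ∀ (n : Fin d → ℤ) (y : Y), zdMap T n y = y → n = 0

/-- The graph on `Y` with the edges `(y, T_j y)` and `(y, T_j⁻¹ y)`. -/
def schreierGraph {Y : Type u} [MeasurableSpace Y] [StandardBorelSpace Y] {d : ℕ}
    (T : Fin d → Y ≃ᵐ Y) : BorelGraph Y where
  Adj x y := ∃ j, y = T j x ∨ y = (T j).symm x
  symm := by
    rintro x y ⟨j, rfl | rfl⟩
    · exact ⟨j, Or.inr (by simp)⟩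
    · exact ⟨j, Or.inl (by simp)⟩
  measurableSet_adj := by
    simp only [Set.ofPred_exists, Set.ofPred_or]
    exact MeasurableSet.iUnion fun j =>
      (measurableSet_eq_fun measurable_snd ((T j).measurable.comp measurable_fst)).union
        (measurableSet_eq_fun measurable_snd ((T j).symm.measurable.comp measurable_fst))

/-! A Borel 2-coloring ("checkerboard") of part of the graph maps to any edge of `H`. Two opposite
checkerboards can be joined across a strip of odd width `L` by running once around an odd closed
walk of length `L`, which `H` has because it is connected and not bipartite.
`exists_measurable_hom_on_iUnion` therefore needs only Borel sets `X n`, each containing the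
`L`-thickening of the previous one, with checkerboards near each of them that need not agree.

The checkerboards come from region growing (`exists_almost_checkerboard`). Well-separated centers
carve out boxes of the points still available, each stopped at a radius where one more layer adds at
most a fraction `1 / k` of the points. Such a radius exists below a uniform bound because boxes grow
polynomially. Discarding the outer layers leaves pairwise non-adjacent pieces, colored by the parity
of the displacement to the center. Invariance turns the count into a measure bound, uniform in the
invariant probability measure.

In `exists_measurable_hom_conull`, Borel–Cantelli turns sets of rapidly increasing measure into the
sequence `X n`, off a null set. The triangle as `H` gives three colors. For two colors, the null set
is made invariant; each `T i` then exchanges the two color classes. -/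

/-! ### Odd closed walks in a connected non-bipartite graph -/

namespace BorelGraph

variable {W : Type v} [MeasurableSpace W]

/-- There is a walk of the given length between two vertices. -/
inductive HasWalk (H : BorelGraph W) : ℕ → W → W → Prop
  | nil (x : W) : HasWalk H 0 x x
  | cons {n : ℕ} {x y z : W} : H.Adj x y → HasWalk H n y z → HasWalk H (n + 1) x z

theorem HasWalk.append {H : BorelGraph W} {m n : ℕ} {x y z : W} (h : H.HasWalk m x y)
    (h' : H.HasWalk n y z) : H.HasWalk (m + n) x z := by
  induction h with
  | nil x => simpa using h'
  | cons hxy _ ih => rw [Nat.add_right_comm]; exact .cons hxy (ih h')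

theorem HasWalk.reverse {H : BorelGraph W} {n : ℕ} {x y : W} (h : H.HasWalk n x y) :
    H.HasWalk n y x := by
  induction h with
  | nil x => exact .nil x
  | cons hxy _ ih => exact ih.append (.cons (H.symm _ _ hxy) (.nil _))

theorem HasWalk.exists_seq {H : BorelGraph W} {n : ℕ} {x y : W} (h : H.HasWalk n x y) :
    ∃ w : ℕ → W, w 0 = x ∧ w n = y ∧ ∀ i < n, H.Adj (w i) (w (i + 1)) := by
  induction h with
  | nil x => exact ⟨fun _ => x, rfl, rfl, by simp⟩
  | @cons n x y z hxy _ ih =>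
    obtain ⟨w, h0, hn, hw⟩ := ih
    refine ⟨fun i => i.casesOn x w, rfl, hn, ?_⟩
    rintro (_ | i) hi
    · simpa [h0] using hxy
    · exact hw i (by omega)

/-- Color each vertex by the parity of a chosen walk from a base point. An edge inside one color
class closes up two such walks to an odd one. -/
theorem exists_odd_closed_hasWalk (H : BorelGraph W) (hc : H.Connected) (hb : ¬ H.Bipartite) :
    ∃ (L : ℕ) (v : W), Odd L ∧ H.HasWalk L v v := by
  obtain ⟨⟨v⟩, hc⟩ := hc
  have hwalk : ∀ x, ∃ n, H.HasWalk n v x := by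
    intro x
    induction hc v x with
    | refl => exact ⟨0, .nil v⟩
    | tail _ hbc ih =>
      obtain ⟨n, hn⟩ := ih
      exact ⟨n + 1, hn.append (.cons hbc (.nil _))⟩
  choose len hlen using hwalk
  by_contra! hodd
  refine hb ⟨fun x => decide (Odd (len x)), fun x y hxy heq => ?_⟩
  have hw := ((hlen x).append (.cons hxy (.nil y))).append (hlen y).reverse
  refine hodd _ v ?_ hw
  have : Odd (len x) ↔ Odd (len y) := by simpa using heq
  grind

/-- A closed walk of odd length `L`, continued by one more step. -/
theorem exists_odd_closed_walk_seq (H : BorelGraph W) (hc : H.Connected) (hb : ¬ H.Bipartite) :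
    ∃ (L : ℕ) (w : ℕ → W), Odd L ∧ w L = w 0 ∧ w (L + 1) = w 1 ∧
      ∀ i ≤ L, H.Adj (w i) (w (i + 1)) := by
  obtain ⟨L, v, hL, h⟩ := H.exists_odd_closed_hasWalk hc hb
  obtain ⟨w, h0, hn, hw⟩ := h.exists_seq
  have hpos : 0 < L := hL.pos
  refine ⟨L, fun i => if i = L + 1 then w 1 else w i, hL, ?_, ?_, ?_⟩
  · simp [h0, hn]
  · by_cases h1 : (1 : ℕ) = L + 1
    · omega
    · simp only [if_true, if_neg h1]
  · intro i hi
    rcases hi.lt_or_eq with hi | rfl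
    · have := hw i hi
      simpa only [if_neg (show i ≠ L + 1 by omega), if_neg (show i + 1 ≠ L + 1 by omega)]
    · have := hw 0 hpos
      simpa [h0, hn] using this

end BorelGraph

/-! ### Interpolation between two checkerboard patterns -/

/-- The least integer `≥ t` whose parity is given by `a`. -/
def parityCeil (t : ℕ) (a : Bool) : ℕ := if (t % 2 = 1 ↔ a = true) then t else t + 1

/-- Rounding to opposite parities makes the difference odd, and it is too small to be anything but
`±1`. This is needed because adjacent points may have equal depth. -/
theorem parityCeil_succ_or {s t : ℕ} {a : Bool} (hst : s ≤ t + 1) (hts : t ≤ s + 1) :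
    parityCeil s a + 1 = parityCeil t (!a) ∨ parityCeil t (!a) + 1 = parityCeil s a := by
  unfold parityCeil
  cases a <;> simp <;> grind

/-- The vertex of the walk `w` at depth `t` of the transition from the checkerboard pattern `a`
to the checkerboard pattern `b`. -/
def transition {W : Type v} (w : ℕ → W) (t : ℕ) (a b : Bool) : W :=
  if a = b then w b.toNat else w (parityCeil t a)

theorem transition_zero {W : Type v} (w : ℕ → W) (a b : Bool) :
    transition w 0 a b = w a.toNat := by
  cases a <;> cases b <;> simp [transition, parityCeil]

/-- Going once around the odd walk flips the parity: rounding `L` gives `L` or `L + 1`, which `w`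
identifies with `0` and `1`. The rounding up to `L + 1` is why the walk is continued by one step. -/
theorem transition_last {W : Type v} {w : ℕ → W} {L : ℕ} (hL : Odd L) (h0 : w L = w 0)
    (h1 : w (L + 1) = w 1) (a b : Bool) : transition w L a b = w b.toNat := by
  have := Nat.odd_iff.1 hL
  cases a <;> cases b <;> simp [transition, parityCeil, this, h0, h1]

theorem adj_transition {W : Type v} [MeasurableSpace W] {H : BorelGraph W} {w : ℕ → W} {L : ℕ}
    (hL : Odd L) (hw : ∀ i ≤ L, H.Adj (w i) (w (i + 1))) {s t : ℕ} (hs : s ≤ L) (ht : t ≤ L)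
    (hst : s ≤ t + 1) (hts : t ≤ s + 1) (a b : Bool) :
    H.Adj (transition w s a b) (transition w t (!a) (!b)) := by
  have hL0 := hL.pos
  by_cases hab : a = b
  · subst hab
    cases a
    · simpa [transition] using hw 0 (by omega)
    · simpa [transition] using H.symm _ _ (hw 0 (by omega))
  · simp only [transition, if_neg hab, Bool.not_inj_iff]
    have hle : ∀ r a, parityCeil r a ≤ r + 1 := fun r a => by unfold parityCeil; split <;> omega
    have hsa := hle s a
    have hta := hle t (!a)
    rcases parityCeil_succ_or (a := a) hst hts with h | h
    · rw [← h]; exact hw _ (by omega)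
    · rw [← h]; exact H.symm _ _ (hw _ (by omega))

/-! ### Boxes in `ℤ^d` and thickenings -/

/-- The box `[-r, r]^d`. -/
noncomputable def zdBox (d r : ℕ) : Finset (Fin d → ℤ) := Finset.Icc (fun _ => -(r : ℤ)) (fun _ => (r : ℤ))

section Box

variable {d : ℕ} {m n : Fin d → ℤ} {r s : ℕ}

theorem mem_zdBox : n ∈ zdBox d r ↔ ∀ i, |n i| ≤ r := by
  simp [zdBox, Pi.le_def, abs_le, forall_and]

theorem zero_mem_zdBox : (0 : Fin d → ℤ) ∈ zdBox d r := by simp [mem_zdBox]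

theorem neg_mem_zdBox (h : n ∈ zdBox d r) : -n ∈ zdBox d r := by simpa [mem_zdBox] using h

theorem add_mem_zdBox (hm : m ∈ zdBox d r) (hn : n ∈ zdBox d s) : m + n ∈ zdBox d (r + s) := by
  rw [mem_zdBox] at *
  intro i
  have := abs_add_le (m i) (n i)
  have := hm i
  have := hn i
  simp only [Pi.add_apply]
  push_cast
  omega

theorem zdBox_mono (h : r ≤ s) : zdBox d r ⊆ zdBox d s := by
  intro n hn
  rw [mem_zdBox] at *
  exact fun i => (hn i).trans (by exact_mod_cast h)

theorem card_zdBox : (zdBox d r).card = (2 * r + 1) ^ d := by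
  simp only [zdBox, Pi.card_Icc, Int.card_Icc, Finset.prod_const, Finset.card_univ,
    Fintype.card_fin]
  congr 1
  omega

end Box

section Thicken

variable {Y : Type u} {d : ℕ} [AddAction (Fin d → ℤ) Y]

/-- The points at distance at most `r` from `X` along the orbits. -/
def zdThicken (d r : ℕ) {Y : Type u} [AddAction (Fin d → ℤ) Y] (X : Set Y) : Set Y :=
  {x | ∃ n ∈ zdBox d r, n +ᵥ x ∈ X}

theorem measurableSet_zdThicken [MeasurableSpace Y] [MeasurableConstVAdd (Fin d → ℤ) Y] (r : ℕ) {X : Set Y}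
    (hX : MeasurableSet X) : MeasurableSet (zdThicken d r X) := by
  have : zdThicken d r X = ⋃ n ∈ zdBox d r, (fun x => n +ᵥ x) ⁻¹' X := by
    ext; simp [zdThicken]
  rw [this]
  exact Finset.measurableSet_biUnion _ fun n _ => measurable_const_vadd n hX

theorem vadd_mem_zdThicken {r s : ℕ} {X : Set Y} {x : Y} {n : Fin d → ℤ} (hn : n ∈ zdBox d s)
    (hx : x ∈ zdThicken d r X) : n +ᵥ x ∈ zdThicken d (r + s) X := by
  obtain ⟨m, hm, hmx⟩ := hx
  refine ⟨m + -n, add_mem_zdBox hm (neg_mem_zdBox hn), ?_⟩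
  rwa [add_vadd, neg_vadd_vadd]

theorem zdThicken_mono {r s : ℕ} (h : r ≤ s) (X : Set Y) : zdThicken d r X ⊆ zdThicken d s X :=
  fun _ ⟨n, hn, hx⟩ => ⟨n, zdBox_mono h hn, hx⟩

theorem subset_zdThicken (r : ℕ) (X : Set Y) : X ⊆ zdThicken d r X :=
  fun x hx => ⟨0, zero_mem_zdBox, by simpa using hx⟩

open Classical in
/-- The distance from `x` to `X` along the orbit of `x`, truncated at `L`. -/
noncomputable def zdDist (d L : ℕ) {Y : Type u} [AddAction (Fin d → ℤ) Y] (X : Set Y) (x : Y) :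
    ℕ :=
  Nat.find (p := fun r => x ∈ zdThicken d r X ∨ r = L) ⟨L, Or.inr rfl⟩

theorem measurable_zdDist [MeasurableSpace Y] [MeasurableConstVAdd (Fin d → ℤ) Y] (L : ℕ) {X : Set Y}
    (hX : MeasurableSet X) : Measurable (zdDist d L X) := by
  classical
  refine measurable_find _ fun r => ?_
  exact (measurableSet_zdThicken r hX).union (MeasurableSet.const _)

theorem zdDist_le (L : ℕ) (X : Set Y) (x : Y) : zdDist d L X x ≤ L := by
  classical
  exact Nat.find_min' _ (Or.inr rfl)

theorem zdDist_le_of_mem {L r : ℕ} {X : Set Y} {x : Y} (h : x ∈ zdThicken d r X) :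
    zdDist d L X x ≤ r := by
  classical
  exact Nat.find_min' _ (Or.inl h)

theorem mem_zdThicken_of_zdDist_lt {L : ℕ} {X : Set Y} {x : Y} (h : zdDist d L X x < L) :
    x ∈ zdThicken d (zdDist d L X x) X := by
  classical
  exact (Nat.find_spec (p := fun r => x ∈ zdThicken d r X ∨ r = L) ⟨L, Or.inr rfl⟩).resolve_right
    h.ne

theorem zdDist_vadd_le {L : ℕ} (X : Set Y) (x : Y) {n : Fin d → ℤ} (hn : n ∈ zdBox d 1) :
    zdDist d L X (n +ᵥ x) ≤ zdDist d L X x + 1 := by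
  rcases (zdDist_le (d := d) L X x).lt_or_eq with h | h
  · exact zdDist_le_of_mem (vadd_mem_zdThicken hn (mem_zdThicken_of_zdDist_lt h))
  · rw [h]; exact (zdDist_le (d := d) L X _).trans (by omega)

theorem zdDist_eq_zero {L : ℕ} {X : Set Y} {x : Y} (h : x ∈ X) : zdDist d L X x = 0 :=
  Nat.le_zero.1 (zdDist_le_of_mem (subset_zdThicken 0 X h))

end Thicken

/-! ### Gluing checkerboard patterns on an increasing sequence of sets -/

/-- If checkerboard patterns are given near each of the sets `X n`, and `X (n + 1)` contains the
`L`-thickening of `X n`, then an odd closed walk of length `L` in `H` yields a homomorphism to `H`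
on the union of the `X n`. -/
theorem exists_measurable_hom_on_iUnion {W : Type v} [MeasurableSpace W] (H : BorelGraph W)
    {w : ℕ → W} {L : ℕ} (hL : Odd L) (h0 : w L = w 0) (h1 : w (L + 1) = w 1)
    (hw : ∀ i ≤ L, H.Adj (w i) (w (i + 1)))
    {Y : Type u} [MeasurableSpace Y] {d : ℕ} [AddAction (Fin d → ℤ) Y]
    [MeasurableConstVAdd (Fin d → ℤ) Y] (G : BorelGraph Y)
    (hG : ∀ x y, G.Adj x y → ∃ n ∈ zdBox d 1, y = n +ᵥ x)
    (X : ℕ → Set Y) (hXm : ∀ n, MeasurableSet (X n)) (hX0 : X 0 = ∅)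
    (hX : ∀ n, zdThicken d L (X n) ⊆ X (n + 1))
    (p : ℕ → Y → Bool) (hpm : ∀ n, Measurable (p n))
    (hp : ∀ n x y, x ∈ zdThicken d L (X n) → y ∈ zdThicken d L (X n) → G.Adj x y →
      p n y = !p n x) :
    ∃ f : Y → W, Measurable f ∧
      ∀ x y, x ∈ ⋃ n, X n → y ∈ ⋃ n, X n → G.Adj x y → H.Adj (f x) (f y) := by
  classical
  have hLpos := hL.pos
  have hsub : ∀ n, X n ⊆ X (n + 1) := fun n => (subset_zdThicken L (X n)).trans (hX n)
  have hmono : Monotone X := monotone_nat_of_le_succ hsub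
  have hdist : ∀ n x y, G.Adj x y → zdDist d L (X n) y ≤ zdDist d L (X n) x + 1 := by
    intro n x y hxy
    obtain ⟨v, hv, rfl⟩ := hG x y hxy
    exact zdDist_vadd_le _ _ hv
  have hnear : ∀ n x, zdDist d L (X n) x < L → x ∈ zdThicken d L (X n) := fun n x h =>
    zdThicken_mono h.le _ (mem_zdThicken_of_zdDist_lt h)
  have hnear_adj : ∀ n x y, G.Adj x y → zdDist d L (X n) x < L → y ∈ zdThicken d L (X n) := by
    intro n x y hxy h
    obtain ⟨v, hv, rfl⟩ := hG x y hxy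
    exact zdThicken_mono (by omega) _ (vadd_mem_zdThicken hv (mem_zdThicken_of_zdDist_lt h))
  -- `g n` shows pattern `p n` on `X n` and pattern `p (n + 1)` at distance `L` or more. It is used
  -- on the layer `X (n + 1) \ X n`.
  let g : ℕ → Y → W := fun n x => transition w (zdDist d L (X n) x) (p n x) (p (n + 1) x)
  have hgm : ∀ n, Measurable (g n) := fun n => by
    have : Measurable fun q : ℕ × Bool × Bool => transition w q.1 q.2.1 q.2.2 :=
      measurable_of_countable _
    exact this.comp ((measurable_zdDist L (hXm n)).prodMk ((hpm n).prodMk (hpm (n + 1))))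
  have hlast : ∀ n x, zdDist d L (X n) x = L → g n x = w (p (n + 1) x).toNat := by
    intro n x h
    simp only [g, h]
    exact transition_last hL h0 h1 _ _
  have hg : ∀ n x y, x ∈ X (n + 1) → y ∈ X (n + 1) → G.Adj x y → H.Adj (g n x) (g n y) := by
    intro n x y hx hy hxy
    have hflip := hp (n + 1) x y (subset_zdThicken _ _ hx) (subset_zdThicken _ _ hy) hxy
    by_cases hxn : x ∈ zdThicken d L (X n) ∧ y ∈ zdThicken d L (X n)
    · have hflip' := hp n x y hxn.1 hxn.2 hxy
      simp only [g, hflip, hflip']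
      exact adj_transition hL hw (zdDist_le _ _ _) (zdDist_le _ _ _)
        (hdist n y x (G.symm _ _ hxy)) (hdist n x y hxy) _ _
    · have hxL : zdDist d L (X n) x = L := by
        refine ((zdDist_le L (X n) x).lt_or_eq).resolve_left fun h => hxn ?_
        exact ⟨hnear n x h, hnear_adj n x y hxy h⟩
      have hyL : zdDist d L (X n) y = L := by
        refine ((zdDist_le L (X n) y).lt_or_eq).resolve_left fun h => hxn ?_
        exact ⟨hnear_adj n y x (G.symm _ _ hxy) h, hnear n y h⟩
      rw [hlast n x hxL, hlast n y hyL, hflip]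
      cases p (n + 1) x
      · simpa using hw 0 (by omega)
      · simpa using H.symm _ _ (hw 0 (by omega))
  have hex : ∀ x, ∃ n, x ∈ X (n + 1) ∨ x ∉ ⋃ n, X n := by
    intro x
    by_cases hx : x ∈ ⋃ n, X n
    · obtain ⟨n, hn⟩ := Set.mem_iUnion.1 hx
      exact ⟨n, Or.inl (hsub n hn)⟩
    · exact ⟨0, Or.inr hx⟩
  have hspec : ∀ x ∈ ⋃ n, X n, x ∈ X (Nat.find (hex x) + 1) ∧ x ∉ X (Nat.find (hex x)) := by
    intro x hx
    refine ⟨(Nat.find_spec (hex x)).resolve_right (not_not.2 hx), ?_⟩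
    have hmin : ∀ i < Nat.find (hex x), x ∉ X (i + 1) := fun i hi hxi =>
      Nat.find_min (hex x) hi (Or.inl hxi)
    generalize Nat.find (hex x) = j at hmin
    cases j with
    | zero => simp [hX0]
    | succ j => exact hmin j j.lt_succ_self
  refine ⟨fun x => g (Nat.find (hex x)) x, Measurable.find hgm (fun n => ?_) hex, ?_⟩
  · exact (hXm (n + 1)).union (MeasurableSet.iUnion hXm).compl
  have key : ∀ x y, x ∈ ⋃ n, X n → y ∈ ⋃ n, X n → G.Adj x y →
      Nat.find (hex x) ≤ Nat.find (hex y) →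
      H.Adj (g (Nat.find (hex x)) x) (g (Nat.find (hex y)) y) := by
    intro x y hx hy hxy hle
    obtain ⟨hxn, hxn'⟩ := hspec x hx
    obtain ⟨hyn, hyn'⟩ := hspec y hy
    generalize Nat.find (hex x) = i at *
    generalize Nat.find (hex y) = j at *
    rcases hle.lt_or_eq with hlt | rfl
    · have hyi : y ∈ X (i + 2) := by
        obtain ⟨v, hv, rfl⟩ := hG x y hxy
        refine hX _ (zdThicken_mono hLpos _ ?_)
        simpa using vadd_mem_zdThicken (r := 0) hv (subset_zdThicken _ _ hxn)
      have hij : j = i + 1 := by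
        by_contra hne
        exact hyn' (hmono (show i + 2 ≤ j by omega) hyi)
      subst hij
      -- If `x` were closer, its neighbor `y` would lie in the `L`-thickening of `X i`, hence in `X
      -- (i + 1)`. So the transition of `g i` is complete at `x` and that of `g (i + 1)` has not
      -- begun: both show `p (i + 1)`.
      have hxL : zdDist d L (X i) x = L :=
        ((zdDist_le L (X i) x).lt_or_eq).resolve_left fun h =>
          hyn' (hX i (hnear_adj i x y hxy h))
      have hgx : g i x = g (i + 1) x := by
        rw [hlast i x hxL]
        simp only [g, zdDist_eq_zero hxn, transition_zero]
      rw [hgx]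
      exact hg (i + 1) x y (hsub _ hxn) hyn hxy
    · exact hg i x y hxn hyn hxy
  intro x y hx hy hxy
  rcases le_total (Nat.find (hex x)) (Nat.find (hex y)) with hle | hle
  · exact key x y hx hy hxy hle
  · exact H.symm _ _ (key y x hy hx (G.symm _ _ hxy) hle)

/-! ### Region growing -/

section RegionGrowing

variable {Y : Type u} {d : ℕ} [AddAction (Fin d → ℤ) Y]

/-- A free action on a standard Borel space has a countable Borel cover by sets which do not meet
their translates by the nonzero elements of a given finite set. -/
theorem exists_cover_disjoint_translates [MeasurableSpace Y] [StandardBorelSpace Y]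
    [MeasurableConstVAdd (Fin d → ℤ) Y]
    (hfree : ∀ (n : Fin d → ℤ) (y : Y), n +ᵥ y = y → n = 0) (F : Finset (Fin d → ℤ)) :
    ∃ U : ℕ → Set Y, (∀ i, MeasurableSet (U i)) ∧ (⋃ i, U i) = Set.univ ∧
      ∀ i, ∀ x ∈ U i, ∀ n ∈ F, n +ᵥ x ∈ U i → n = 0 := by
  classical
  obtain ⟨e, he⟩ := exists_surjective_nat (ℚ × ℚ)
  let g : Y → ℝ := embeddingReal Y
  have hg : MeasurableEmbedding g := measurableEmbedding_embeddingReal Y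
  let I : ℕ → Set ℝ := fun i => Set.Ioo ((e i).1 : ℝ) ((e i).2 : ℝ)
  have hI : ∀ i, MeasurableSet (I i) := fun i => measurableSet_Ioo
  -- After embedding `Y` in `ℝ`, freeness lets a rational interval isolate each point from its
  -- finitely many translates.
  let U : ℕ → Set Y := fun i => (g ⁻¹' I i) ∩ ⋂ n ∈ F.erase 0, {y | g (n +ᵥ y) ∈ (I i)ᶜ}
  refine ⟨U, fun i => ?_, ?_, ?_⟩
  · refine (hg.measurable (hI i)).inter (Finset.measurableSet_biInter _ fun n _ => ?_)
    exact (hg.measurable.comp (measurable_const_vadd n)) (hI i).compl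
  · refine Set.eq_univ_of_forall fun y => ?_
    let S : Set ℝ := (fun n : Fin d → ℤ => g (n +ᵥ y)) '' ↑(F.erase 0)
    have hS : IsOpen Sᶜ := ((Finset.finite_toSet _).image _).isClosed.isOpen_compl
    have hy : g y ∈ Sᶜ := by
      rintro ⟨n, hn, hny⟩
      have := hfree n y (hg.injective hny)
      simp [this] at hn
    obtain ⟨V, hV, hyV, hVS⟩ := Real.isTopologicalBasis_Ioo_rat.exists_subset_of_mem_open hy hS
    simp only [Set.mem_iUnion, Set.mem_singleton_iff] at hV
    obtain ⟨a, b, _, rfl⟩ := hV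
    obtain ⟨i, hi⟩ := he (a, b)
    have hIi : I i = Set.Ioo (a : ℝ) (b : ℝ) := by simp [I, hi]
    refine Set.mem_iUnion.2 ⟨i, by simpa [hIi] using hyV, ?_⟩
    refine Set.mem_iInter₂.2 fun n hn => ?_
    intro h
    rw [hIi] at h
    exact hVS h ⟨n, hn, rfl⟩
  · rintro i x ⟨_, hx⟩ n hn ⟨hnx, _⟩
    by_contra hne
    exact Set.mem_iInter₂.1 hx n (Finset.mem_erase.2 ⟨hne, hn⟩) hnx

open Classical in
/-- The number of points of `Z` in the box of radius `r` around `y`. -/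
noncomputable def boxCount (d : ℕ) {Y : Type u} [AddAction (Fin d → ℤ) Y] (Z : Set Y) (r : ℕ)
    (y : Y) : ℕ :=
  ((zdBox d r).filter fun n => n +ᵥ y ∈ Z).card

theorem measurable_boxCount [MeasurableSpace Y] [MeasurableConstVAdd (Fin d → ℤ) Y] {Z : Set Y}
    (hZ : MeasurableSet Z) (r : ℕ) : Measurable (boxCount d Z r) := by
  classical
  have : boxCount d Z r = fun y => ∑ n ∈ zdBox d r, if n +ᵥ y ∈ Z then 1 else 0 := by
    ext y
    rw [boxCount, Finset.card_filter]
  rw [this]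
  refine Finset.measurable_sum _ fun n _ => ?_
  exact Measurable.ite (measurable_const_vadd n hZ) measurable_const measurable_const

theorem one_le_boxCount_zero {Z : Set Y} {y : Y} (hy : y ∈ Z) : 1 ≤ boxCount d Z 0 y := by
  classical
  refine Finset.card_pos.2 ⟨0, ?_⟩
  simpa [zero_mem_zdBox] using hy

theorem boxCount_le (Z : Set Y) (r : ℕ) (y : Y) : boxCount d Z r y ≤ (2 * r + 1) ^ d := by
  classical
  exact (Finset.card_filter_le _ _).trans card_zdBox.le

/-- Exponential growth beats polynomial growth. -/
theorem exists_pow_mul_lt_pow (d k : ℕ) (hk : 0 < k) :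
    ∃ R : ℕ, k ^ R * (2 * R + 1) ^ d < (k + 1) ^ R := by
  have hk' : (0 : ℝ) < k := by exact_mod_cast hk
  have hq : (1 : ℝ) < (k + 1) / k := by rw [lt_div_iff₀ hk']; linarith
  have h := (tendsto_pow_const_div_const_pow_of_one_lt d hq).const_mul (3 ^ d : ℝ)
  rw [mul_zero] at h
  obtain ⟨R, hR, hR1⟩ := ((h.eventually (gt_mem_nhds one_pos)).and
    (Filter.eventually_ge_atTop 1)).exists
  refine ⟨R, ?_⟩
  have hqR : (0 : ℝ) < ((k + 1) / k) ^ R := by positivity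
  have h3 : ((2 * R + 1 : ℝ)) ^ d ≤ 3 ^ d * (R : ℝ) ^ d := by
    rw [← mul_pow]
    have : (1 : ℝ) ≤ R := by exact_mod_cast hR1
    exact pow_le_pow_left₀ (by positivity) (by linarith) d
  rw [← mul_div_assoc, div_lt_one hqR, div_pow, lt_div_iff₀ (by positivity)] at hR
  have : (k : ℝ) ^ R * (2 * R + 1) ^ d < (k + 1) ^ R :=
    lt_of_le_of_lt (by rw [mul_comm]; gcongr) hR
  exact_mod_cast this

open Classical in
/-- The first radius, capped at `R`, at which the number of points of `Z` in boxes around `y` grows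
by a factor of at most `(k + 1) / k`. -/
noncomputable def slowRadius (d k R : ℕ) {Y : Type u} [AddAction (Fin d → ℤ) Y] (Z : Set Y)
    (y : Y) : ℕ :=
  Nat.find (p := fun r => k * boxCount d Z (r + 1) y ≤ (k + 1) * boxCount d Z r y ∨ r = R)
    ⟨R, Or.inr rfl⟩

theorem measurable_slowRadius [MeasurableSpace Y] [MeasurableConstVAdd (Fin d → ℤ) Y] (k R : ℕ)
    {Z : Set Y} (hZ : MeasurableSet Z) : Measurable (slowRadius d k R Z) := by
  classical
  refine measurable_find _ fun r => ?_
  have h : MeasurableSet {y : Y | k * boxCount d Z (r + 1) y ≤ (k + 1) * boxCount d Z r y} :=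
    measurableSet_le ((measurable_boxCount hZ _).const_mul _)
      ((measurable_boxCount hZ _).const_mul _)
  exact h.union (MeasurableSet.const _)

theorem slowRadius_le (k R : ℕ) (Z : Set Y) (y : Y) : slowRadius d k R Z y ≤ R := by
  classical
  exact Nat.find_min' _ (Or.inr rfl)

/-- The cap is never what stops the search: fast growth at all radii below `R`, starting from the
point `y` itself, would put more points in the box of radius `R` than it has. -/
theorem boxCount_slowRadius_succ_le {k R : ℕ} (hR : k ^ R * (2 * R + 1) ^ d < (k + 1) ^ R)
    {Z : Set Y} {y : Y} (hy : y ∈ Z) :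
    k * boxCount d Z (slowRadius d k R Z y + 1) y ≤
      (k + 1) * boxCount d Z (slowRadius d k R Z y) y := by
  classical
  have hspec := Nat.find_spec
    (p := fun r => k * boxCount d Z (r + 1) y ≤ (k + 1) * boxCount d Z r y ∨ r = R)
    ⟨R, Or.inr rfl⟩
  refine hspec.resolve_right fun h => ?_
  have hfast : ∀ r < R, (k + 1) * boxCount d Z r y < k * boxCount d Z (r + 1) y := by
    intro r hr
    rw [← h] at hr
    have := Nat.find_min _ hr
    push Not at this
    exact this.1
  have hgrow : ∀ r ≤ R, (k + 1) ^ r ≤ k ^ r * boxCount d Z r y := by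
    intro r
    induction r with
    | zero => intro _; simpa using one_le_boxCount_zero hy
    | succ r ih =>
      intro hr
      calc (k + 1) ^ (r + 1) = (k + 1) ^ r * (k + 1) := pow_succ _ _
        _ ≤ k ^ r * boxCount d Z r y * (k + 1) := by gcongr; exact ih (by omega)
        _ = k ^ r * ((k + 1) * boxCount d Z r y) := by ring
        _ ≤ k ^ r * (k * boxCount d Z (r + 1) y) := Nat.mul_le_mul_left _ (hfast r (by omega)).le
        _ = k ^ (r + 1) * boxCount d Z (r + 1) y := by ring
  have := hgrow R le_rfl
  have := Nat.mul_le_mul_left (k ^ R) (boxCount_le (d := d) Z R y)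
  omega

/-- The points of `Z` lying in a box of radius `q c` around some center `c ∈ C`, with a displacement
to the center satisfying `Q`. -/
def boxUnion (d R : ℕ) {Y : Type u} [AddAction (Fin d → ℤ) Y] (Q : (Fin d → ℤ) → Prop)
    (C Z : Set Y) (q : Y → ℕ) : Set Y :=
  {x | x ∈ Z ∧ ∃ n ∈ zdBox d R, n +ᵥ x ∈ C ∧ n ∈ zdBox d (q (n +ᵥ x)) ∧ Q n}

theorem measurableSet_boxUnion [MeasurableSpace Y] [MeasurableConstVAdd (Fin d → ℤ) Y] (R : ℕ)
    (Q : (Fin d → ℤ) → Prop) {C Z : Set Y} (hC : MeasurableSet C) (hZ : MeasurableSet Z)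
    {q : Y → ℕ} (hq : Measurable q) : MeasurableSet (boxUnion d R Q C Z q) := by
  have : boxUnion d R Q C Z q = Z ∩ ⋃ n ∈ zdBox d R,
      (fun x => n +ᵥ x) ⁻¹' (C ∩ q ⁻¹' {r | n ∈ zdBox d r ∧ Q n}) := by
    ext x
    simp only [boxUnion, Set.mem_ofPred_eq, Set.mem_inter_iff, Set.mem_iUnion, Set.mem_preimage,
      exists_prop]
  rw [this]
  refine hZ.inter (Finset.measurableSet_biUnion _ fun n _ => measurable_const_vadd n ?_)
  exact hC.inter (hq (MeasurableSet.of_discrete))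

/-- The measure of a union of disjoint boxes is the integral over the centers of the number of
points in the boxes. -/
theorem measure_boxUnion [MeasurableSpace Y] [MeasurableConstVAdd (Fin d → ℤ) Y] {R : ℕ}
    {C Z : Set Y} (hC : MeasurableSet C) (hZ : MeasurableSet Z) {q : Y → ℕ} (hq : Measurable q)
    (hqR : ∀ y, q y ≤ R)
    (hsep : ∀ x ∈ C, ∀ n ∈ zdBox d (R + R), n +ᵥ x ∈ C → n = 0)
    (μ : Measure Y) (hμ : ∀ (n : Fin d → ℤ) (S : Set Y), MeasurableSet S →
      μ ((fun x => n +ᵥ x) ⁻¹' S) = μ S) :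
    μ (boxUnion d R (fun _ => True) C Z q) = ∫⁻ y in C, (boxCount d Z (q y) y : ENNReal) ∂μ := by
  classical
  -- Mass transport: `B n` collects the centers of the points with displacement `n`. Separation
  -- makes the center unique, so the pulled-back sets are disjoint, and invariance moves their mass
  -- to the centers.
  let B : (Fin d → ℤ) → Set Y := fun n => {y | y ∈ C ∧ n ∈ zdBox d (q y) ∧ -n +ᵥ y ∈ Z}
  have hB : ∀ n, MeasurableSet (B n) := fun n =>
    hC.inter (MeasurableSet.inter (hq (MeasurableSet.of_discrete (s := {r | n ∈ zdBox d r})))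
      (measurable_const_vadd (-n) hZ))
  have hunion : boxUnion d R (fun _ => True) C Z q =
      ⋃ n ∈ zdBox d R, (fun x => n +ᵥ x) ⁻¹' B n := by
    ext x
    simp only [boxUnion, B, Set.mem_ofPred_eq, Set.mem_iUnion, Set.mem_preimage, neg_vadd_vadd]
    tauto
  have hdisj : Set.PairwiseDisjoint (↑(zdBox d R)) fun n => (fun x => n +ᵥ x) ⁻¹' B n := by
    intro m hm n hn hmn
    refine Set.disjoint_left.2 fun x hxm hxn => hmn ?_
    have := hsep (m +ᵥ x) hxm.1 (n + -m) (add_mem_zdBox hn (neg_mem_zdBox hm))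
      (by rw [add_vadd, neg_vadd_vadd]; exact hxn.1)
    rw [← sub_eq_add_neg, sub_eq_zero] at this
    exact this.symm
  rw [hunion, measure_biUnion_finset hdisj fun n _ => measurable_const_vadd n (hB n)]
  have hcount : ∀ y ∈ C, (boxCount d Z (q y) y : ENNReal) =
      ∑ n ∈ zdBox d R, (B n).indicator 1 y := by
    intro y hy
    simp only [Set.indicator_apply, Pi.one_apply]
    rw [← Finset.natCast_card_filter, Nat.cast_inj, boxCount]
    refine Finset.card_bij (fun n _ => -n) ?_ (fun _ _ _ _ h => neg_injective h) ?_
    · intro n hn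
      rw [Finset.mem_filter] at hn ⊢
      have hnb := neg_mem_zdBox hn.1
      exact ⟨zdBox_mono (hqR y) hnb, hy, hnb, by simpa using hn.2⟩
    · intro n hn
      rw [Finset.mem_filter] at hn
      exact ⟨-n, Finset.mem_filter.2 ⟨neg_mem_zdBox hn.2.2.1, hn.2.2.2⟩, neg_neg n⟩
  rw [setLIntegral_congr_fun hC hcount,
    lintegral_finsetSum _ fun n _ => measurable_one.indicator (hB n)]
  refine Finset.sum_congr rfl fun n _ => ?_
  rw [hμ n _ (hB n), lintegral_indicator_one (hB n), Measure.restrict_apply (hB n)]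
  congr 1
  ext y
  simp only [B, Set.mem_ofPred_eq, Set.mem_inter_iff]
  tauto

end RegionGrowing

/-! ### Almost checkerboards by region growing, and homomorphisms off a null set -/

section Checkerboard

variable {Y : Type u} [MeasurableSpace Y] [StandardBorelSpace Y] {d : ℕ}
  [AddAction (Fin d → ℤ) Y] [MeasurableConstVAdd (Fin d → ℤ) Y]

/-- Region growing, uniformly over all invariant probability measures: the graph is 2-colored by a
Borel map on a Borel set whose complement has measure at most `1 / k`. -/
theorem exists_almost_checkerboard
    (hfree : ∀ (n : Fin d → ℤ) (y : Y), n +ᵥ y = y → n = 0) (G : BorelGraph Y)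
    (hG : ∀ x y, G.Adj x y → ∃ n ∈ zdBox d 1, Odd (∑ i, n i) ∧ y = n +ᵥ x)
    (k : ℕ) (hk : 0 < k) :
    ∃ (A : Set Y) (p : Y → Bool), MeasurableSet A ∧ Measurable p ∧
      (∀ x y, x ∈ A → y ∈ A → G.Adj x y → p y = !p x) ∧
      ∀ μ : Measure Y, IsProbabilityMeasure μ → (∀ (n : Fin d → ℤ) (S : Set Y),
        MeasurableSet S → μ ((fun x => n +ᵥ x) ⁻¹' S) = μ S) → k * μ Aᶜ ≤ 1 := by
  classical
  obtain ⟨R, hR⟩ := exists_pow_mul_lt_pow d k hk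
  -- Enlarged boxes have radius at most `R + 1`, so this separation keeps those around different
  -- centers in one `U i` disjoint.
  obtain ⟨U, hUm, hUcover, hUsep⟩ :=
    exists_cover_disjoint_translates hfree (zdBox d ((R + 1) + (R + 1)))
  let rad : Set Y → Y → ℕ := slowRadius d k R
  let big : ℕ → Set Y → Set Y := fun i Z =>
    boxUnion d (R + 1) (fun _ => True) (U i ∩ Z) Z fun y => rad Z y + 1
  -- `Z i` is what is still available at stage `i`. The whole enlarged box is removed, although only
  -- the inner box is kept as a piece.
  let Z : ℕ → Set Y := fun i => Nat.rec Set.univ (fun i Z => Z \ big i Z) i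
  have hZsucc : ∀ i, Z (i + 1) = Z i \ big i (Z i) := fun i => rfl
  have hbigm : ∀ i S, MeasurableSet S → MeasurableSet (big i S) := fun i S hS =>
    measurableSet_boxUnion _ _ ((hUm i).inter hS) hS
      ((measurable_slowRadius k R hS).add_const 1)
  have hZm : ∀ i, MeasurableSet (Z i) := by
    intro i
    induction i with
    | zero => exact MeasurableSet.univ
    | succ i ih => rw [hZsucc]; exact ih.diff (hbigm i _ ih)
  have hZanti : Antitone Z := antitone_nat_of_succ_le fun i => by
    rw [hZsucc]; exact Set.sdiff_subset
  let part : ((Fin d → ℤ) → Prop) → ℕ → Set Y := fun Q i =>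
    boxUnion d (R + 1) Q (U i ∩ Z i) (Z i) (rad (Z i))
  have hpartm : ∀ Q i, MeasurableSet (part Q i) := fun Q i =>
    measurableSet_boxUnion _ _ ((hUm i).inter (hZm i)) (hZm i) (measurable_slowRadius k R (hZm i))
  let piece : ℕ → Set Y := part fun _ => True
  have hpiece_big : ∀ i, piece i ⊆ big i (Z i) := by
    rintro i x ⟨hx, n, hn, hnx, hnr, -⟩
    exact ⟨hx, n, hn, hnx, zdBox_mono (Nat.le_succ _) hnr, trivial⟩
  have hcenter : ∀ i x, ∀ m ∈ zdBox d (R + 1), ∀ n ∈ zdBox d (R + 1), m +ᵥ x ∈ U i →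
      n +ᵥ x ∈ U i → m = n := by
    intro i x m hm n hn hmx hnx
    have := hUsep i _ hnx (m + -n) (add_mem_zdBox hm (neg_mem_zdBox hn))
      (by rwa [add_vadd, neg_vadd_vadd])
    rwa [← sub_eq_add_neg, sub_eq_zero] at this
  have hindex : ∀ i j x, x ∈ big i (Z i) → x ∈ Z j → j ≤ i := by
    intro i j x hx hxj
    by_contra! hij
    have : x ∈ Z (i + 1) := hZanti hij hxj
    rw [hZsucc] at this
    exact this.2 hx
  have hcover : ∀ x, ∃ i, x ∈ big i (Z i) := by
    intro x
    by_contra! hx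
    have hxZ : ∀ i, x ∈ Z i := by
      intro i
      induction i with
      | zero => trivial
      | succ i ih => rw [hZsucc]; exact ⟨ih, hx i⟩
    obtain ⟨i, hi⟩ := Set.mem_iUnion.1 (hUcover ▸ Set.mem_univ x)
    exact hx i ⟨hxZ i, 0, zero_mem_zdBox, by simpa using ⟨hi, hxZ i⟩, zero_mem_zdBox, trivial⟩
  -- Stage and center of a point in a piece are unique, so one global Borel set records the parity
  -- of its displacement.
  have hparity : ∀ i x, x ∈ Z i → ∀ n ∈ zdBox d (R + 1), n +ᵥ x ∈ U i ∩ Z i →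
      n ∈ zdBox d (rad (Z i) (n +ᵥ x)) →
      (x ∈ ⋃ i, part (fun n => Even (∑ i, n i)) i ↔ Even (∑ i, n i)) := by
    intro i x hx n hn hnx hnr
    constructor
    · intro h
      obtain ⟨j, hxj, m, hm, hmx, hmr, heven⟩ := Set.mem_iUnion.1 h
      have hi : x ∈ piece i := ⟨hx, n, hn, hnx, hnr, trivial⟩
      have hj : x ∈ piece j := ⟨hxj, m, hm, hmx, hmr, trivial⟩
      obtain rfl : i = j :=
        le_antisymm (hindex j i x (hpiece_big j hj) hx) (hindex i j x (hpiece_big i hi) hxj)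
      rwa [hcenter i x n hn m hm hnx.1 hmx.1]
    · intro h
      exact Set.mem_iUnion.2 ⟨i, hx, n, hn, hnx, hnr, h⟩
  refine ⟨⋃ i, piece i, fun x => decide (x ∈ ⋃ i, part (fun n => Even (∑ i, n i)) i),
    MeasurableSet.iUnion fun i => hpartm _ i, ?_, ?_, ?_⟩
  · refine measurable_to_bool ?_
    have : (fun x => decide (x ∈ ⋃ i, part (fun n => Even (∑ i, n i)) i)) ⁻¹' {true} =
        ⋃ i, part (fun n => Even (∑ i, n i)) i := by
      ext x; simp
    rw [this]
    exact MeasurableSet.iUnion fun i => hpartm _ i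
  · intro x y hx hy hxy
    obtain ⟨i, hi⟩ := Set.mem_iUnion.1 hx
    obtain ⟨j, hj⟩ := Set.mem_iUnion.1 hy
    -- a neighbour of a piece which is still available lies in the enlarged piece
    have hnbr : ∀ i x y, x ∈ piece i → G.Adj x y → y ∈ Z i → y ∈ big i (Z i) := by
      rintro i x y ⟨hxi, n, hn, hnx, hnr, -⟩ hxy hyi
      obtain ⟨e, he, -, rfl⟩ := hG x y hxy
      have hb := add_mem_zdBox hnr (neg_mem_zdBox he)
      have hv : (n + -e) +ᵥ (e +ᵥ x) = n +ᵥ x := by rw [add_vadd, neg_vadd_vadd]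
      refine ⟨hyi, n + -e, zdBox_mono ?_ hb, by rwa [hv], by rwa [hv], trivial⟩
      exact Nat.succ_le_succ (slowRadius_le k R (Z i) _)
    -- Adjacent points belong to the same stage: the earlier piece would have removed the neighbor
    -- together with its outer layer.
    obtain rfl : i = j := by
      rcases le_total i j with hij | hij
      · exact le_antisymm hij
          (hindex i j y (hnbr i x y hi hxy (hZanti hij hj.1)) hj.1)
      · exact le_antisymm
          (hindex j i x (hnbr j y x hj (G.symm _ _ hxy) (hZanti hij hi.1)) hi.1) hij
    obtain ⟨hxi, n, hn, hnx, hnr, -⟩ := hi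
    obtain ⟨hyi, m, hm, hmy, hmr, -⟩ := hj
    have hxp := hparity i x hxi n hn hnx hnr
    have hyp := hparity i y hyi m hm hmy hmr
    obtain ⟨e, he, hodd, rfl⟩ := hG x y hxy
    have hv : (n + -e) +ᵥ (e +ᵥ x) = n +ᵥ x := by rw [add_vadd, neg_vadd_vadd]
    have hb : n + -e ∈ zdBox d (R + 1) := zdBox_mono (Nat.succ_le_succ (slowRadius_le k R (Z i) _))
      (add_mem_zdBox hnr (neg_mem_zdBox he))
    have hme : m = n + -e := hcenter i _ m hm _ hb hmy.1 (by rw [hv]; exact hnx.1)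
    have hsum : ∑ i, m i = ∑ i, n i - ∑ i, e i := by
      simp [hme, Finset.sum_add_distrib, sub_eq_add_neg]
    rw [hsum, Int.even_sub] at hyp
    have hnot : ¬ Even (∑ i, e i) := Int.not_even_iff_odd.2 hodd
    rw [← hxp] at hyp
    rw [← decide_not, decide_eq_decide]
    tauto
  · intro μ _ hμ
    have hstep : ∀ i, k * μ (big i (Z i) \ piece i) ≤ μ (piece i) := by
      intro i
      have hCm := (hUm i).inter (hZm i)
      have hsep : ∀ x ∈ U i ∩ Z i, ∀ n ∈ zdBox d ((R + 1) + (R + 1)), n +ᵥ x ∈ U i ∩ Z i → n = 0 :=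
        fun x hx n hn hnx => hUsep i x hx.1 n hn hnx.1
      have hradm : Measurable (rad (Z i)) := measurable_slowRadius k R (hZm i)
      have hle : k * μ (big i (Z i)) ≤ (k + 1) * μ (piece i) := by
        have h1 : μ (big i (Z i)) =
            ∫⁻ y in U i ∩ Z i, (boxCount d (Z i) (rad (Z i) y + 1) y : ENNReal) ∂μ :=
          measure_boxUnion hCm (hZm i) (hradm.add_const 1)
            (fun y => Nat.succ_le_succ (slowRadius_le k R (Z i) y)) hsep μ hμ
        have h2 : μ (piece i) =
            ∫⁻ y in U i ∩ Z i, (boxCount d (Z i) (rad (Z i) y) y : ENNReal) ∂μ :=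
          measure_boxUnion hCm (hZm i) hradm
            (fun y => (slowRadius_le k R (Z i) y).trans (Nat.le_succ R)) hsep μ hμ
        rw [h1, h2, ← lintegral_const_mul' _ _ (by simp), ← lintegral_const_mul' _ _ (by simp)]
        refine setLIntegral_mono' hCm fun y hy => ?_
        exact_mod_cast boxCount_slowRadius_succ_le hR hy.2
      have hadd := measure_sdiff_add_inter (μ := μ) (big i (Z i)) (hpartm (fun _ => True) i)
      rw [Set.inter_eq_self_of_subset_right (hpiece_big i)] at hadd
      -- Cancelling `k * μ (piece i)`, which is finite, leaves the bound on the outer layer.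
      rw [← hadd, mul_add, add_mul, one_mul, add_comm] at hle
      exact (ENNReal.add_le_add_iff_left
        (ENNReal.mul_ne_top (by simp) (measure_ne_top μ _))).1 hle
    have hsub : (⋃ i, piece i)ᶜ ⊆ ⋃ i, (big i (Z i) \ piece i) := by
      intro x hx
      obtain ⟨i, hi⟩ := hcover x
      exact Set.mem_iUnion.2 ⟨i, hi, fun h => hx (Set.mem_iUnion.2 ⟨i, h⟩)⟩
    have hdisj : Pairwise (Function.onFun Disjoint piece) := by
      intro i j hij
      refine Set.disjoint_left.2 fun x hi hj => hij ?_
      exact le_antisymm (hindex j i x (hpiece_big j hj) hi.1) (hindex i j x (hpiece_big i hi) hj.1)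
    calc k * μ (⋃ i, piece i)ᶜ ≤ k * ∑' i, μ (big i (Z i) \ piece i) := by
          gcongr
          exact (measure_mono hsub).trans (measure_iUnion_le _)
      _ = ∑' i, k * μ (big i (Z i) \ piece i) := ENNReal.tsum_mul_left.symm
      _ ≤ ∑' i, μ (piece i) := ENNReal.tsum_le_tsum hstep
      _ = μ (⋃ i, piece i) := (measure_iUnion hdisj fun i => hpartm _ i).symm
      _ ≤ 1 := prob_le_one

/-- Homomorphisms to a connected non-bipartite graph, off a set which is null for all invariant
probability measures. -/
theorem exists_measurable_hom_conull {W : Type v} [MeasurableSpace W] (H : BorelGraph W)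
    (hc : H.Connected) (hb : ¬ H.Bipartite)
    (hfree : ∀ (n : Fin d → ℤ) (y : Y), n +ᵥ y = y → n = 0) (G : BorelGraph Y)
    (hG : ∀ x y, G.Adj x y → ∃ n ∈ zdBox d 1, Odd (∑ i, n i) ∧ y = n +ᵥ x) :
    ∃ (f : Y → W) (N : Set Y), Measurable f ∧ MeasurableSet N ∧
      (∀ x y, x ∉ N → y ∉ N → G.Adj x y → H.Adj (f x) (f y)) ∧
      ∀ μ : Measure Y, IsProbabilityMeasure μ → (∀ (n : Fin d → ℤ) (S : Set Y),
        MeasurableSet S → μ ((fun x => n +ᵥ x) ⁻¹' S) = μ S) → μ N = 0 := by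
  obtain ⟨L, w, hL, h0, h1, hw⟩ := H.exists_odd_closed_walk_seq hc hb
  -- The number of translates in the union bound for `S m` below; the factor `2 ^ m` makes those
  -- bounds summable.
  let size : ℕ → ℕ := fun m => (2 * (L * (m + 1)) + 1) ^ d
  have hsize : ∀ m, 0 < size m := fun m => by positivity
  choose A p hAm hpm hp hA using fun m =>
    exists_almost_checkerboard hfree G hG (2 ^ m * size m) (Nat.mul_pos (by positivity) (hsize m))
  -- The required radius drops by `L` when `n` grows by one, which leaves room for the thickening;
  -- at `m = n` it is `L`, so `p n` is valid on the whole thickening of `X n`.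
  let X : ℕ → Set Y := fun n => {x | ∀ m, n ≤ m → ∀ v ∈ zdBox d (L * (m + 1 - n)), v +ᵥ x ∈ A m}
  have hXm : ∀ n, MeasurableSet (X n) := by
    intro n
    have : X n = ⋂ m, ⋂ (_ : n ≤ m), ⋂ v ∈ zdBox d (L * (m + 1 - n)),
        (fun x => v +ᵥ x) ⁻¹' A m := by
      ext x; simp [X]
    rw [this]
    exact MeasurableSet.iInter fun m => MeasurableSet.iInter fun _ =>
      Finset.measurableSet_biInter _ fun v _ => measurable_const_vadd v (hAm m)
  have hthick : ∀ n, zdThicken d L (X n) ⊆ X (n + 1) := by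
    rintro n x ⟨v, hv, hx⟩ m hm u hu
    have hb := add_mem_zdBox hu (neg_mem_zdBox hv)
    have hlen : L * (m + 1 - (n + 1)) + L = L * (m + 1 - n) := by
      rw [show m + 1 - n = (m + 1 - (n + 1)) + 1 by omega]; ring
    rw [hlen] at hb
    have := hx m (by omega) _ hb
    rwa [add_vadd, neg_vadd_vadd] at this
  have hthickA : ∀ n, zdThicken d L (X n) ⊆ A n := by
    rintro n x ⟨v, hv, hx⟩
    have := hx n le_rfl (-v) (by simpa using neg_mem_zdBox hv)
    rwa [neg_vadd_vadd] at this
  obtain ⟨f, hfm, hf⟩ := exists_measurable_hom_on_iUnion H hL h0 h1 hw G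
    (fun x y hxy => let ⟨n, hn, _, h⟩ := hG x y hxy; ⟨n, hn, h⟩)
    (fun n => n.casesOn ∅ X) (fun n => by cases n; exacts [MeasurableSet.empty, hXm _]) rfl
    (fun n => by
      cases n
      · rintro x ⟨v, _, hx⟩; exact hx.elim
      · exact hthick _)
    (fun n => n.casesOn (fun _ => false) p)
    (fun n => by cases n; exacts [measurable_const, hpm _])
    (fun n x y hx hy hxy => by
      cases n
      · obtain ⟨v, _, hx⟩ := hx; exact hx.elim
      · exact hp _ x y (hthickA _ hx) (hthickA _ hy) hxy)
  have hmem : ∀ x ∈ ⋃ n, X n, x ∈ ⋃ n : ℕ, (n.casesOn ∅ X : Set Y) := by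
    intro x hx
    obtain ⟨n, hn⟩ := Set.mem_iUnion.1 hx
    exact Set.mem_iUnion.2 ⟨n + 1, hn⟩
  refine ⟨f, (⋃ n, X n)ᶜ, hfm, (MeasurableSet.iUnion hXm).compl, fun x y hx hy hxy =>
    hf x y (hmem x (not_not.1 hx)) (hmem y (not_not.1 hy)) hxy, ?_⟩
  intro μ _ hμ
  let S : ℕ → Set Y := fun m => ⋃ v ∈ zdBox d (L * (m + 1)), (fun x => v +ᵥ x) ⁻¹' (A m)ᶜ
  have hS : ∀ m, μ (S m) ≤ (2⁻¹ : ENNReal) ^ m := by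
    intro m
    have hle : μ (S m) ≤ size m * μ (A m)ᶜ := by
      refine (measure_biUnion_finset_le _ _).trans ?_
      rw [Finset.sum_congr rfl fun v _ => hμ v _ (hAm m).compl, Finset.sum_const, card_zdBox,
        nsmul_eq_mul]
    have h2 : 2 ^ m * μ (S m) ≤ 1 := by
      refine le_trans ?_ (hA m μ inferInstance hμ)
      push_cast
      rw [mul_assoc]
      gcongr
    rw [← ENNReal.inv_pow, ENNReal.le_inv_iff_mul_le, mul_comm]
    exact h2
  have hlim : μ (Filter.limsup S Filter.atTop) = 0 := by
    refine measure_limsup_atTop_eq_zero (ne_top_of_le_ne_top ?_ (ENNReal.tsum_le_tsum hS))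
    rw [ENNReal.tsum_geometric]
    simp
  refine measure_mono_null (fun x hx => ?_) hlim
  -- A point in only finitely many `S m` lies in `X n` once `n` is past the last of them.
  rw [Filter.mem_limsup_iff_frequently_mem, Filter.frequently_atTop]
  intro n
  by_contra! hno
  refine hx (Set.mem_iUnion.2 ⟨n, fun m hm v hv => ?_⟩)
  by_contra hmem
  exact hno m hm (Set.mem_iUnion₂.2
    ⟨v, zdBox_mono (Nat.mul_le_mul_left L (Nat.sub_le _ _)) hv, hmem⟩)

end Checkerboard

/-! ### The action of `ℤ^d` -/

section Action

variable {Y : Type u} [MeasurableSpace Y] {d : ℕ} {T : Fin d → Y ≃ᵐ Y}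

namespace GeneratesFreeZdAction

/-- `zdMap` is an ordered product in a noncommutative group. Factoring it through the commutative
subgroup generated by the `T i` allows its factors to be rearranged. -/
theorem exists_zdMap_eq_prod (hT : GeneratesFreeZdAction T) :
    ∃ (K : Type u) (_ : CommGroup K) (φ : K →* Equiv.Perm Y) (t : Fin d → K),
      (∀ i, φ (t i) = (T i).toEquiv) ∧ ∀ n, zdMap T n = φ (∏ i, t i ^ n i) := by
  let C : Subgroup (Equiv.Perm Y) := Subgroup.closure (Set.range fun i => (T i).toEquiv)
  have hC : IsMulCommutative C := by
    refine Subgroup.isMulCommutative_closure ?_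
    rintro _ ⟨i, rfl⟩ _ ⟨j, rfl⟩
    ext y
    exact hT.comm i j y
  let _ : CommGroup C := { (inferInstance : Group C) with mul_comm := hC.is_comm.comm }
  refine ⟨C, inferInstance, C.subtype, fun i => ⟨_, Subgroup.subset_closure ⟨i, rfl⟩⟩,
    fun i => rfl, fun n => ?_⟩
  rw [← List.prod_ofFn, map_list_prod, List.map_ofFn]
  rfl

theorem zdMap_add (hT : GeneratesFreeZdAction T) (m n : Fin d → ℤ) :
    zdMap T (m + n) = zdMap T m * zdMap T n := by
  obtain ⟨K, _, φ, t, -, h⟩ := hT.exists_zdMap_eq_prod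
  simp only [h, Pi.add_apply, zpow_add, Finset.prod_mul_distrib, map_mul]

theorem zdMap_single (hT : GeneratesFreeZdAction T) (j : Fin d) (a : ℤ) :
    zdMap T (Pi.single j a) = ((T j).toEquiv : Equiv.Perm Y) ^ a := by
  obtain ⟨K, _, φ, t, ht, h⟩ := hT.exists_zdMap_eq_prod
  rw [h, Finset.prod_eq_single j]
  · simp [ht]
  · intro i _ hij
    simp [Pi.single_eq_of_ne hij]
  · simp

theorem zdMap_zero (hT : GeneratesFreeZdAction T) : zdMap T 0 = 1 := by
  obtain ⟨K, _, φ, t, -, h⟩ := hT.exists_zdMap_eq_prod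
  simp [h]

/-- The action of `ℤ^d` generated by `T`. -/
@[reducible]
def addAction (hT : GeneratesFreeZdAction T) : AddAction (Fin d → ℤ) Y where
  vadd n y := zdMap T n y
  zero_vadd y := congrArg (fun σ : Equiv.Perm Y => σ y) hT.zdMap_zero
  add_vadd m n y := congrArg (fun σ : Equiv.Perm Y => σ y) (hT.zdMap_add m n)

end GeneratesFreeZdAction

/-- Stated for submonoids so that closure under inverses need not be checked for all measurable or
measure-preserving permutations, only for the generators. -/
theorem zdMap_mem (M : Submonoid (Equiv.Perm Y)) (h : ∀ i, (T i).toEquiv ∈ M)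
    (h' : ∀ i, (T i).symm.toEquiv ∈ M) (n : Fin d → ℤ) : zdMap T n ∈ M := by
  refine M.list_prod_mem fun σ hσ => ?_
  obtain ⟨i, rfl⟩ := (List.mem_ofFn' _ _).1 hσ
  change (T i).toEquiv ^ n i ∈ M
  rcases n i with a | a
  · rw [Int.ofNat_eq_natCast, zpow_natCast]
    exact M.pow_mem (h i) a
  · rw [zpow_negSucc, ← inv_pow]
    exact M.pow_mem (h' i) _

theorem measurable_zdMap (n : Fin d → ℤ) : Measurable (zdMap T n) :=
  zdMap_mem
    { carrier := {σ : Equiv.Perm Y | Measurable σ}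
      one_mem' := measurable_id
      mul_mem' := fun hσ hτ => hσ.comp hτ }
    (fun i => (T i).measurable) (fun i => (T i).symm.measurable) n

variable [StandardBorelSpace Y] {μ : Measure Y}

theorem BorelGraph.Invariant.measurePreserving (hμ : (schreierGraph T).Invariant μ) (i : Fin d) :
    MeasurePreserving (T i) μ μ :=
  ⟨(T i).measurable, hμ (T i) fun _ => ⟨i, Or.inl rfl⟩⟩

theorem BorelGraph.Invariant.measurePreserving_zdMap (hμ : (schreierGraph T).Invariant μ)
    (n : Fin d → ℤ) : MeasurePreserving (zdMap T n) μ μ :=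
  zdMap_mem
    { carrier := {σ : Equiv.Perm Y | MeasurePreserving σ μ μ}
      one_mem' := MeasurePreserving.id μ
      mul_mem' := fun hσ hτ => hσ.comp hτ }
    hμ.measurePreserving (fun i => (hμ.measurePreserving i).symm (T i)) n

/-- The graph of a free action of `ℤ^d` admits Borel almost homomorphisms to all connected
non-bipartite graphs. -/
theorem exists_isAlmostHom (hT : GeneratesFreeZdAction T) {W : Type v} [MeasurableSpace W]
    (H : BorelGraph W) (hc : H.Connected) (hb : ¬ H.Bipartite) :
    ∃ f : Y → W, (schreierGraph T).IsAlmostHom H f := by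
  let _ : AddAction (Fin d → ℤ) Y := hT.addAction
  have : MeasurableConstVAdd (Fin d → ℤ) Y := ⟨measurable_zdMap⟩
  have hedge : ∀ x y, (schreierGraph T).Adj x y →
      ∃ n ∈ zdBox d 1, Odd (∑ i, n i) ∧ y = n +ᵥ x := by
    have hmem : ∀ (j : Fin d) (a : ℤ), |a| ≤ 1 → Pi.single j a ∈ zdBox d 1 := by
      intro j a ha
      refine mem_zdBox.2 fun i => ?_
      by_cases hij : i = j
      · subst hij; simpa using ha
      · simp [Pi.single_eq_of_ne hij]
    rintro x y ⟨j, rfl | rfl⟩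
    · refine ⟨Pi.single j 1, hmem j 1 (by simp), by simp, ?_⟩
      change _ = zdMap T _ x
      rw [hT.zdMap_single, zpow_one]
      rfl
    · refine ⟨Pi.single j (-1), hmem j (-1) (by simp), by simp, ?_⟩
      change _ = zdMap T _ x
      rw [hT.zdMap_single, zpow_neg_one]
      rfl
  obtain ⟨f, N, hf, hN, hhom, hnull⟩ :=
    exists_measurable_hom_conull H hc hb hT.free (schreierGraph T) hedge
  exact ⟨f, hf, N, ⟨hN, fun μ hμ hinv => hnull μ hμ fun n S hS =>
    (hinv.measurePreserving_zdMap n).measure_preimage hS.nullMeasurableSet⟩, hhom⟩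

end Action

/-! ### Almost Borel chromatic numbers -/

section Chromatic

variable {Y : Type u} [MeasurableSpace Y] [StandardBorelSpace Y] {d : ℕ} {T : Fin d → Y ≃ᵐ Y}

theorem almostBorelColorable_three (hT : GeneratesFreeZdAction T) :
    (schreierGraph T).AlmostBorelColorable 3 := by
  let K : BorelGraph (Fin 3) :=
    { Adj := fun x y => x ≠ y
      symm := fun _ _ h => h.symm
      measurableSet_adj := MeasurableSet.of_discrete }
  have hc : K.Connected := by
    refine ⟨⟨0⟩, fun x y => ?_⟩
    by_cases h : x = y
    · exact h ▸ .refl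
    · exact .single h
  have hb : ¬ K.Bipartite := by
    rintro ⟨c, hc⟩
    have h01 := hc 0 1 (by decide)
    have h02 := hc 0 2 (by decide)
    have h12 := hc 1 2 (by decide)
    revert h01 h02 h12
    cases c 0 <;> cases c 1 <;> cases c 2 <;> simp
  obtain ⟨f, hf, N, hN, h⟩ := exists_isAlmostHom hT K hc hb
  exact ⟨f, hf, N, hN, h⟩

theorem BorelGraph.AlmostBorelColorable.two_le (hd : 0 < d)
    (hY : ¬ (schreierGraph T).IsNull Set.univ) {k : ℕ}
    (h : (schreierGraph T).AlmostBorelColorable k) : 2 ≤ k := by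
  obtain ⟨c, -, N, hN, hc⟩ := h
  by_contra! hk
  have hsub : Subsingleton (Fin k) := Fin.subsingleton_iff_le_one.2 (by omega)
  refine hY ⟨MeasurableSet.univ, fun μ hμ hinv => ?_⟩
  -- With at most one color, every edge has an endpoint in `N`.
  have huniv : Set.univ ⊆ N ∪ T ⟨0, hd⟩ ⁻¹' N := by
    intro x _
    by_contra hx
    rw [Set.mem_union, not_or] at hx
    exact hc x _ hx.1 hx.2 ⟨⟨0, hd⟩, Or.inl rfl⟩ (Subsingleton.elim _ _)
  have hN0 := hN.2 μ hμ hinv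
  refine measure_mono_null huniv (measure_union_null hN0 ?_)
  rwa [(hinv.measurePreserving _).measure_preimage hN.1.nullMeasurableSet]

theorem BorelGraph.exists_almostBorelColorable_of_chromaticNumber_lt {V : Type u}
    [MeasurableSpace V] {G : BorelGraph V} {m : ℕ} (h : G.almostBorelChromaticNumber < m) :
    ∃ k < m, G.AlmostBorelColorable k := by
  simp only [almostBorelChromaticNumber, iInf_lt_iff] at h
  obtain ⟨k, hk, hkm⟩ := h
  exact ⟨k, by exact_mod_cast hkm, hk⟩

theorem BorelGraph.AlmostBorelColorable.chromaticNumber_le {V : Type u} [MeasurableSpace V]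
    {G : BorelGraph V} {k : ℕ} (h : G.AlmostBorelColorable k) :
    G.almostBorelChromaticNumber ≤ k :=
  iInf₂_le k h

theorem two_le_almostBorelChromaticNumber (hd : 0 < d)
    (hY : ¬ (schreierGraph T).IsNull Set.univ) :
    2 ≤ (schreierGraph T).almostBorelChromaticNumber :=
  le_iInf₂ fun _ hk => by exact_mod_cast BorelGraph.AlmostBorelColorable.two_le hd hY hk

theorem almostBorelChromaticNumber_eq_two_iff (hd : 0 < d)
    (hY : ¬ (schreierGraph T).IsNull Set.univ) :
    (schreierGraph T).almostBorelChromaticNumber = 2 ↔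
      (schreierGraph T).AlmostBorelColorable 2 := by
  constructor
  · intro h
    obtain ⟨k, hk, hcol⟩ := BorelGraph.exists_almostBorelColorable_of_chromaticNumber_lt
      (G := schreierGraph T) (m := 3) (by rw [h]; norm_num)
    have := hcol.two_le hd hY
    obtain rfl : k = 2 := by omega
    exact hcol
  · exact fun h => le_antisymm h.chromaticNumber_le (two_le_almostBorelChromaticNumber hd hY)

/-- A null set is contained in an invariant null set. -/
theorem BorelGraph.IsNull.exists_invariant_superset (hT : GeneratesFreeZdAction T) {N : Set Y}
    (hN : (schreierGraph T).IsNull N) :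
    ∃ N' : Set Y, N ⊆ N' ∧ (schreierGraph T).IsNull N' ∧ ∀ i x, T i x ∈ N' ↔ x ∈ N' := by
  refine ⟨⋃ n : Fin d → ℤ, zdMap T n ⁻¹' N, ?_, ⟨?_, ?_⟩, ?_⟩
  · exact fun x hx => Set.mem_iUnion.2 ⟨0, by simpa [hT.zdMap_zero] using hx⟩
  · exact MeasurableSet.iUnion fun n => measurable_zdMap n hN.1
  · intro μ hμ hinv
    refine measure_iUnion_null fun n => ?_
    rw [(hinv.measurePreserving_zdMap n).measure_preimage hN.1.nullMeasurableSet]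
    exact hN.2 μ hμ hinv
  · intro i x
    have hstep : ∀ n : Fin d → ℤ, zdMap T (n + Pi.single i 1) x = zdMap T n (T i x) := by
      intro n
      rw [hT.zdMap_add, hT.zdMap_single, zpow_one]
      rfl
    simp only [Set.mem_iUnion, Set.mem_preimage]
    constructor
    · rintro ⟨n, hn⟩
      exact ⟨n + Pi.single i 1, by rwa [hstep]⟩
    · rintro ⟨n, hn⟩
      exact ⟨n - Pi.single i 1, by rwa [← hstep, sub_add_cancel]⟩

theorem almostBorelColorable_two_iff (hT : GeneratesFreeZdAction T) :
    (schreierGraph T).AlmostBorelColorable 2 ↔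
      ∃ Y₀ Y₁ : Set Y, MeasurableSet Y₀ ∧ MeasurableSet Y₁ ∧ Disjoint Y₀ Y₁ ∧
        (schreierGraph T).IsNull (Y₀ ∪ Y₁)ᶜ ∧ ∀ i, T i '' Y₀ = Y₁ ∧ T i '' Y₁ = Y₀ := by
  classical
  constructor
  · rintro ⟨c, hcm, N, hN, hc⟩
    -- Off an invariant set both endpoints of an edge are good at once, so the images of the color
    -- classes are exact and not just almost equal.
    obtain ⟨N', hNN', hN', hinv⟩ := hN.exists_invariant_superset hT
    have hcol : ∀ a, MeasurableSet (c ⁻¹' {a} \ N') := fun a =>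
      (hcm (measurableSet_singleton a)).diff hN'.1
    have htwo : ∀ a b e : Fin 2, a ≠ b → (e = a ∨ e = b) := by decide
    have himage : ∀ i a b, a ≠ b → T i '' (c ⁻¹' {a} \ N') = c ⁻¹' {b} \ N' := by
      intro i a b hab
      have hflip : ∀ x ∉ N', c x ≠ c (T i x) := fun x hx =>
        hc x _ (fun h => hx (hNN' h)) (fun h => hx ((hinv i x).1 (hNN' h))) ⟨i, Or.inl rfl⟩
      ext y
      obtain ⟨x, rfl⟩ := (T i).surjective y
      rw [(T i).injective.mem_set_image]
      simp only [Set.mem_sdiff, Set.mem_preimage, Set.mem_singleton_iff, hinv i x]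
      refine and_congr_left fun hx => ?_
      have h1 := hflip x hx
      have h2 := htwo a b (c x) hab
      have h3 := htwo a b (c (T i x)) hab
      grind
    refine ⟨c ⁻¹' {0} \ N', c ⁻¹' {1} \ N', hcol 0, hcol 1, ?_, ?_, fun i =>
      ⟨himage i 0 1 (by decide), himage i 1 0 (by decide)⟩⟩
    · refine Set.disjoint_left.2 fun x h0 h1 => ?_
      have h0 : c x = 0 := h0.1
      have h1 : c x = 1 := h1.1
      simp [h0] at h1
    · have : (c ⁻¹' {0} \ N' ∪ c ⁻¹' {1} \ N')ᶜ = N' := by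
        ext x
        have := htwo 0 1 (c x) (by decide)
        simp only [Set.mem_compl_iff, Set.mem_union, Set.mem_sdiff, Set.mem_preimage,
          Set.mem_singleton_iff]
        tauto
      rwa [this]
  · rintro ⟨Y₀, Y₁, h0, h1, hdisj, hnull, himage⟩
    refine ⟨fun x => if x ∈ Y₀ then 0 else 1, Measurable.ite h0 measurable_const measurable_const,
      _, hnull, ?_⟩
    have hstep : ∀ i x, x ∈ Y₀ ∪ Y₁ →
        (if x ∈ Y₀ then (0 : Fin 2) else 1) ≠ if T i x ∈ Y₀ then 0 else 1 := by
      rintro i x (hx | hx)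
      · have hTx : T i x ∈ Y₁ := (himage i).1 ▸ Set.mem_image_of_mem _ hx
        simp [hx, Set.disjoint_right.1 hdisj hTx]
      · have hTx : T i x ∈ Y₀ := (himage i).2 ▸ Set.mem_image_of_mem _ hx
        simp [hTx, Set.disjoint_right.1 hdisj hx]
    rintro x y hx hy ⟨i, rfl | rfl⟩
    · exact hstep i x (not_not.1 hx)
    · have := hstep i _ (not_not.1 hy)
      rw [MeasurableEquiv.apply_symm_apply] at this
      exact this.symm

end Chromatic

theorem mainTheorem10 {Y : Type u} [MeasurableSpace Y] [StandardBorelSpace Y] {d : ℕ}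
    (T : Fin d → Y ≃ᵐ Y) (hT : GeneratesFreeZdAction T) :
    (∀ (W : Type v) [Finite W] [MeasurableSpace W] [DiscreteMeasurableSpace W]
        (H : BorelGraph W), H.Connected → ¬ H.Bipartite →
        ∃ f : Y → W, (schreierGraph T).IsAlmostHom H f) ∧
    (schreierGraph T).almostBorelChromaticNumber ≤ 3 ∧
    (0 < d → ¬ (schreierGraph T).IsNull Set.univ →
      ((schreierGraph T).almostBorelChromaticNumber = 2 ∨
        (schreierGraph T).almostBorelChromaticNumber = 3) ∧
      ((schreierGraph T).almostBorelChromaticNumber = 2 ↔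
        ∃ Y₀ Y₁ : Set Y, MeasurableSet Y₀ ∧ MeasurableSet Y₁ ∧ Disjoint Y₀ Y₁ ∧
          (schreierGraph T).IsNull (Y₀ ∪ Y₁)ᶜ ∧
          ∀ i, T i '' Y₀ = Y₁ ∧ T i '' Y₁ = Y₀)) := by
  have hle : (schreierGraph T).almostBorelChromaticNumber ≤ 3 :=
    (almostBorelColorable_three hT).chromaticNumber_le
  refine ⟨fun W _ _ _ H hc hb => exists_isAlmostHom hT H hc hb, hle, fun hd hY => ⟨?_, ?_⟩⟩
  · rcases hle.lt_or_eq with h | h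
    · obtain ⟨k, hk, hcol⟩ := BorelGraph.exists_almostBorelColorable_of_chromaticNumber_lt
        (G := schreierGraph T) (m := 3) h
      have := hcol.two_le hd hY
      obtain rfl : k = 2 := by omega
      exact Or.inl ((almostBorelChromaticNumber_eq_two_iff hd hY).2 hcol)
    · exact Or.inr h
  · exact (almostBorelChromaticNumber_eq_two_iff hd hY).trans (almostBorelColorable_two_iff hT)
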